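/- **Setting.** Let $\mathcal H$ be a complex Hilbert space with inner product $(\cdot,\cdot)$ linear in the first variable. Let $H$ be a selfadjoint operator on $\mathcal H$ with spectral measure $E$, so that $H=\int_{\mathbf R}\omega\,dE(\omega)$. Let $K$ be a densely defined linear operator on $\mathcal H$, and put $T=H+K$. Let $\Omega$ be a simply connected open subset of the upper half plane such that $\tilde I=\overline\Omega\cap\mathbf R$ is an interval with nonempty interior $I$, and put $\hat\Omega=\Omega\cup I\cup\{\lambda:\operatorname{Im}\lambda<0\}$. Let $X=X(\Omega)$ be a quasi-complete barreled locally convex Hausdorff space over $\mathbf C$ which is a dense linear subspace of $\mathcal H$ and whose topology is stronger than that of $\mathcal H$. Let $X'$ be the space of continuous antilinear functionals on $X$, and let $i:X\to X'$ be given by $\langle i\psi\,|\,\phi\rangle=(\psi,\phi)$. Let $Y$ be a dense linear subspace of $X$. Assume: 1. For every $\phi\in X$ the measure $(E(\cdot)\phi,\phi)$ is absolutely continuous on $I$, with a density that is the restriction of a function holomorphic on $\Omega\cup I$ (i.e. near each of its points). By polarization, $(E(\cdot)\phi,\psi)$ for $\phi,\psi\in X$ then has on $I$ a density with a holomorphic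 continuation $E[\phi,\psi](\cdot)$ to $\Omega\cup I$. 2. For every $\lambda\in\Omega\cup I$ the form $E[\cdot,\cdot](\lambda)$ is separately continuous on $X\times X$. 3. $Y\subset \mathsf D(H)$ and $HY\subset X$. 4. $K$ is $H$-bounded, $Y\subset\mathsf D(K^*)$ and $K^*Y\subset X$. 5. $K^\times A(\lambda)\,iX\subset iX$ for every $\lambda\in\hat\Omega$, with $K^\times$ and $A(\lambda)$ as follows. For an operator $A$ in $\mathcal H$ whose adjoint satisfies $Y\subset \mathsf D(A^*)$ and $A^*Y\subset X$, the operator $A^\times$ in $X'$ is the dual of $A^*|_Y$: its domain is the set of $\mu\in X'$ for which $\phi\mapsto\langle\mu\,|\,A^*\phi\rangle$ is continuous on $Y$ in the topology of $X$, and $A^\times\mu\in X'$ is determined by $\langle A^\times\mu\,|\,\phi\rangle=\langle\mu\,|\,A^*\phi\rangle$ for $\phi\in Y$. This applies to $K$ and to $T$. For $\lambda\in\hat\Omega$ the operator $A(\lambda):iX\to X'$, the analytic continuation of $(\lambda-H)^{-1}$, is given for $\psi,\phi\in X$ by $$\langle A(\lambda)\,i\psi\,|\,\phi\rangle=\begin{cases}\displaystyle\int_{\mathbf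 R}\frac{d(E(\omega)\psi,\phi)}{\lambda-\omega}+2\pi\sqrt{-1}\,E[\psi,\phi](\lambda)&(\lambda\in\Omega),\\[2mm]\displaystyle\lim_{y\to-0}\int_{\mathbf R}\frac{d(E(\omega)\psi,\phi)}{x+\sqrt{-1}\,y-\omega}&(\lambda=x\in I),\\[2mm]\displaystyle\int_{\mathbf R}\frac{d(E(\omega)\psi,\phi)}{\lambda-\omega}&(\operatorname{Im}\lambda<0).\end{cases}$$ A number $\lambda\in\hat\Omega$ is called a *generalized eigenvalue* of $T$, and $\mu$ a *generalized eigenfunction* associated with $\lambda$, if $\mu$ is a nonzero element of the range of $A(\lambda)$ with $\mu \in \mathsf D(K^\times)$, $K^\times\mu\in iX$ and $$(\mathrm{id}-A(\lambda)K^\times)\mu=0.$$ **Theorem 3.5.** If $\lambda$ is a generalized eigenvalue of $T$ and $\mu$ is a generalized eigenfunction associated with $\lambda$, then $\mu\in\mathsf D(T^\times)$ and $$T^\times\mu=\lambda\mu .$$ In particular every generalized eigenvalue of $T$ (every resonance pole, if $\lambda\in\Omega$) is an eigenvalue of the dual operator $T^\times$. -/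

import Mathlib

open MeasureTheory Set Filter Topology
open scoped LinearPMap
set_option linter.unusedSectionVars false

namespace RiggedSpectral

noncomputable section

/-! ### Spectral measures on the real line -/

section SpectralMeasure

/-- A projection-valued (spectral) measure on the Borel sets of `ℝ`, with values in the orthogonal
projections of a Hilbert space. The values on non-measurable sets are irrelevant. -/
structure SpectralMeasure (ℋ : Type*) [NormedAddCommGroup ℋ] [InnerProductSpace ℂ ℋ]
    [CompleteSpace ℋ] where
  /-- the projection `E(B)` -/
  proj : Set ℝ → (ℋ →L[ℂ] ℋ)
  isStarProjection : ∀ B, MeasurableSet B → IsStarProjection (proj B)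
  proj_empty : proj ∅ = 0
  proj_univ : proj univ = 1
  proj_inter : ∀ B C, MeasurableSet B → MeasurableSet C → proj (B ∩ C) = proj B * proj C
  hasSum_iUnion : ∀ f : ℕ → Set ℝ, (∀ n, MeasurableSet (f n)) →
    Pairwise (Function.onFun Disjoint f) →
    ∀ x : ℋ, HasSum (fun n => proj (f n) x) (proj (⋃ n, f n) x)

variable {ℋ : Type*} [NormedAddCommGroup ℋ] [InnerProductSpace ℂ ℋ] [CompleteSpace ℋ]

open Classical in
/-- The complex measure `B ↦ (E(B)φ, ψ)`. The inner product `(a, b)` of the text is linear in `a`,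
so it is Mathlib's `inner ℂ b a`. -/
def SpectralMeasure.cmeas (E : SpectralMeasure ℋ) (φ ψ : ℋ) : ComplexMeasure ℝ where
  measureOf' B := if MeasurableSet B then inner ℂ ψ (E.proj B φ) else 0
  empty' := by simp [E.proj_empty]
  not_measurable' B hB := by simp [hB]
  m_iUnion' f hf hd := by
    simp only [hf, MeasurableSet.iUnion hf, if_true]
    exact (E.hasSum_iUnion f hf hd φ).mapL (innerSL ℂ ψ)

/-- The integral `∫ g(ω) d(E(ω)φ, ψ)` over `ℝ`. -/
def SpectralMeasure.int (E : SpectralMeasure ℋ) (g : ℝ → ℂ) (φ ψ : ℋ) : ℂ :=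
  (E.cmeas φ ψ).integral g (ContinuousLinearMap.mul ℝ ℂ)

/-- `E` is the spectral measure of `H`, that is `H = ∫ ω dE(ω)`: the domain of `H` consists of the
vectors `x` with `∫ ω² d(E(ω)x, x) < ∞`, and `(Hx, y) = ∫ ω d(E(ω)x, y)`
(an absolutely convergent integral) for `x` in the domain and all `y`. -/
structure SpectralMeasure.IsResolutionOf (E : SpectralMeasure ℋ) (H : ℋ →ₗ.[ℂ] ℋ) : Prop where
  mem_domain_iff : ∀ x : ℋ,
    x ∈ H.domain ↔ (E.cmeas x x).Integrable (fun ω : ℝ => (ω : ℂ) ^ 2)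
  integrable : ∀ (x : H.domain) (y : ℋ), (E.cmeas x y).Integrable (fun ω : ℝ => (ω : ℂ))
  inner_apply : ∀ (x : H.domain) (y : ℋ),
    inner ℂ y (H x) = E.int (fun ω : ℝ => (ω : ℂ)) x y

end SpectralMeasure

/-- `K` is relatively bounded with respect to `H`. -/
def IsRelBounded {ℋ : Type*} [NormedAddCommGroup ℋ] [InnerProductSpace ℂ ℋ]
    (K H : ℋ →ₗ.[ℂ] ℋ) : Prop :=
  ∃ hdom : H.domain ≤ K.domain, ∃ a b : ℝ, ∀ x : H.domain,
    ‖K ⟨x, hdom x.2⟩‖ ≤ a * ‖H x‖ + b * ‖(x : ℋ)‖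

/-! ### The domain `Ω` -/

/-- The set `Ĩ`: the intersection of the real axis with the closure of `Ω`. -/
def realTrace (Ω : Set ℂ) : Set ℝ := {x : ℝ | (x : ℂ) ∈ closure Ω}

/-- The open interval `I = Ĩ \ ∂Ĩ`. -/
def openTrace (Ω : Set ℂ) : Set ℝ := interior (realTrace Ω)

/-- The set `Ω ∪ I` in the complex plane. -/
def withTrace (Ω : Set ℂ) : Set ℂ := Ω ∪ (fun x : ℝ => (x : ℂ)) '' openTrace Ω

/-- The set `Ω ∪ I ∪ {Im λ < 0}`. -/
def extendedDomain (Ω : Set ℂ) : Set ℂ := withTrace Ω ∪ {z : ℂ | z.im < 0}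

/-- The standing assumptions on `Ω`: a simply connected open subset of the upper half plane whose
closure meets the real axis in an interval, with nonempty interior. -/
structure IsAdmissibleDomain (Ω : Set ℂ) : Prop where
  isOpen : IsOpen Ω
  simplyConnected : IsSimplyConnected Ω
  im_pos : ∀ z ∈ Ω, 0 < z.im
  ordConnected : (realTrace Ω).OrdConnected
  nonempty_openTrace : (openTrace Ω).Nonempty

/-! ### Rigged Hilbert spaces, dual operators -/

section Rigged

variable {X : Type*} [AddCommGroup X] [Module ℂ X] [UniformSpace X] [IsUniformAddGroup X]
  [ContinuousSMul ℂ X]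
variable {ℋ : Type*} [NormedAddCommGroup ℋ] [InnerProductSpace ℂ ℋ]

/-- `X` as a dense subspace of `ℋ` with a topology stronger than that of `ℋ`: a continuous injective
linear map `X → ℋ` with dense range. -/
structure Rigging (X ℋ : Type*) [AddCommGroup X] [Module ℂ X] [TopologicalSpace X]
    [NormedAddCommGroup ℋ] [InnerProductSpace ℂ ℋ] where
  incl : X →L[ℂ] ℋ
  injective : Function.Injective incl
  denseRange : DenseRange incl

/-- The canonical inclusion `i : X → X'` into the space `X'` of continuous antilinear functionals,
`⟨i ψ | φ⟩ = (ψ, φ)`. -/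
def Rigging.toDual (R : Rigging X ℋ) (ψ : X) : X →L⋆[ℂ] ℂ where
  toFun φ := inner ℂ (R.incl φ) (R.incl ψ)
  map_add' φ₁ φ₂ := by simp
  map_smul' c φ := by simp [mul_comm]
  cont := by fun_prop

theorem exists_antidual_extension {A : X →ₗ.[ℂ] X} (hA : Dense (A.domain : Set X))
    (μ : X →L⋆[ℂ] ℂ) (hμ : Continuous fun φ : A.domain => μ (A φ)) :
    ∃ ν : X →L⋆[ℂ] ℂ, ∀ φ : A.domain, ν φ = μ (A φ) := by
  let f : A.domain →L⋆[ℂ] ℂ :=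
    { toLinearMap := (μ : X →ₛₗ[starRingEnd ℂ] ℂ).comp A.toFun
      cont := hμ }
  have : IsUniformAddGroup A.domain := A.domain.toAddSubgroup.isUniformAddGroup
  have hd : DenseRange A.domain.subtypeL := by
    simpa [DenseRange] using! hA
  refine ⟨f.extend A.domain.subtypeL, fun φ => ?_⟩
  exact ContinuousLinearMap.extend_eq f hd isUniformEmbedding_subtype_val.isUniformInducing φ

theorem antidual_eq_of_dense {A : X →ₗ.[ℂ] X} (hA : Dense (A.domain : Set X))
    {μ ν : X →L⋆[ℂ] ℂ} (h : ∀ φ : A.domain, μ φ = ν φ) : μ = ν :=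
  DFunLike.coe_injective <|
    Continuous.ext_on hA μ.continuous ν.continuous (fun φ hφ => h ⟨φ, hφ⟩)

/-- The domain of the dual operator `A'` of an operator `A` in `X`: all `μ ∈ X'` for which
`φ ↦ ⟨μ | A φ⟩` is continuous on the domain of `A`. -/
def dualDomain (A : X →ₗ.[ℂ] X) : Submodule ℂ (X →L⋆[ℂ] ℂ) where
  carrier := {μ | Continuous fun φ : A.domain => μ (A φ)}
  add_mem' h₁ h₂ := by simpa using! h₁.add h₂
  zero_mem' := by simpa using! continuous_const
  smul_mem' c μ h := by simpa using! h.const_smul c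

open Classical in
/-- The dual operator `A'` of a densely defined operator `A` in `X`:
`⟨A' μ | φ⟩ = ⟨μ | A φ⟩` for `φ` in the domain of `A` (it is zero by convention if `A` is not
densely defined). -/
def dualOp (A : X →ₗ.[ℂ] X) : (X →L⋆[ℂ] ℂ) →ₗ.[ℂ] (X →L⋆[ℂ] ℂ) where
  domain := dualDomain A
  toFun :=
    if hA : Dense (A.domain : Set X) then
      { toFun := fun μ => (exists_antidual_extension hA μ.1 μ.2).choose
        map_add' := fun μ ν => antidual_eq_of_dense hA fun φ => by
          rw [(exists_antidual_extension hA (μ + ν).1 (μ + ν).2).choose_spec φ, _root_.add_apply,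
            (exists_antidual_extension hA μ.1 μ.2).choose_spec φ,
            (exists_antidual_extension hA ν.1 ν.2).choose_spec φ]
          rfl
        map_smul' := fun c μ => antidual_eq_of_dense hA fun φ => by
          rw [(exists_antidual_extension hA (c • μ).1 (c • μ).2).choose_spec φ,
            RingHom.id_apply, _root_.smul_apply,
            (exists_antidual_extension hA μ.1 μ.2).choose_spec φ]
          rfl }
    else 0

theorem dualOp_apply {A : X →ₗ.[ℂ] X} (hA : Dense (A.domain : Set X)) (μ : (dualOp A).domain)
    (φ : A.domain) : dualOp A μ φ = (μ : X →L⋆[ℂ] ℂ) (A φ) := by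
  change (dualOp A).toFun μ φ = _
  simp only [dualOp, dif_pos hA]
  exact (exists_antidual_extension hA μ.1 μ.2).choose_spec φ

/-- The subspace of those `y ∈ Y` that lie in the domain of `S` and satisfy `S y ∈ X`. -/
def Rigging.restrictDomain (R : Rigging X ℋ) (S : ℋ →ₗ.[ℂ] ℋ) (Y : Submodule ℂ X) :
    Submodule ℂ X where
  carrier := {y | y ∈ Y ∧ ∃ (h : R.incl y ∈ S.domain) (x : X), R.incl x = S ⟨R.incl y, h⟩}
  add_mem' := by
    rintro y z ⟨hy, hy', a, ha⟩ ⟨hz, hz', b, hb⟩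
    refine ⟨Y.add_mem hy hz, by simpa using S.domain.add_mem hy' hz', a + b, ?_⟩
    rw [map_add, ha, hb, ← LinearPMap.map_add]
    congr 1
    ext
    simp
  zero_mem' := by
    refine ⟨Y.zero_mem, by simp, 0, ?_⟩
    refine (map_zero R.incl).trans ((LinearPMap.map_zero S).symm.trans ?_)
    congr 1
    ext
    simp
  smul_mem' := by
    rintro c y ⟨hy, hy', a, ha⟩
    refine ⟨Y.smul_mem c hy, by simpa using S.domain.smul_mem c hy', c • a, ?_⟩
    rw [map_smul, ha, ← LinearPMap.map_smul]
    congr 1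
    ext
    simp

/-- The element `S y` of `X`, for `y` in `restrictDomain`. -/
def Rigging.restrictFun (R : Rigging X ℋ) (S : ℋ →ₗ.[ℂ] ℋ) (Y : Submodule ℂ X)
    (y : R.restrictDomain S Y) : X :=
  y.2.2.2.choose

theorem Rigging.incl_restrictFun (R : Rigging X ℋ) (S : ℋ →ₗ.[ℂ] ℋ) (Y : Submodule ℂ X)
    (y : R.restrictDomain S Y) :
    R.incl (R.restrictFun S Y y) = S ⟨R.incl y, y.2.2.1⟩ :=
  y.2.2.2.choose_spec

/-- The operator in `X` obtained from an operator `S` in `ℋ` by restriction to the subspace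
`Y ⊆ X`: its domain consists of the `y ∈ Y` in the domain of `S` with `S y ∈ X`. -/
def Rigging.restrictTo (R : Rigging X ℋ) (S : ℋ →ₗ.[ℂ] ℋ) (Y : Submodule ℂ X) : X →ₗ.[ℂ] X where
  domain := R.restrictDomain S Y
  toFun :=
    { toFun := R.restrictFun S Y
      map_add' := fun y z => R.injective <| by
        rw [map_add, R.incl_restrictFun, R.incl_restrictFun, R.incl_restrictFun,
          ← LinearPMap.map_add]
        congr 1
        ext
        simp
      map_smul' := fun c y => R.injective <| by
        rw [RingHom.id_apply, map_smul, R.incl_restrictFun, R.incl_restrictFun,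
          ← LinearPMap.map_smul]
        congr 1
        ext
        simp }

/-- The operator `A^× = (A*)'` in `X'`, for an operator `A` in `ℋ`: the dual of the Hilbert space
adjoint `A*`, regarded as an operator in `X` with domain `Y`. -/
def Rigging.cross [CompleteSpace ℋ] (R : Rigging X ℋ) (A : ℋ →ₗ.[ℂ] ℋ) (Y : Submodule ℂ X) :
    (X →L⋆[ℂ] ℂ) →ₗ.[ℂ] (X →L⋆[ℂ] ℂ) :=
  dualOp (R.restrictTo A† Y)

/-! ### Spectral densities and the analytic continuation of the resolvent -/

variable [CompleteSpace ℋ]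

/-- On the interval `I` the complex measure `(E(·)φ, ψ)` is absolutely continuous, with an
(integrable) density that is the restriction of a function `f` holomorphic on `Ω ∪ I`, i.e. near each
point of `Ω ∪ I`. -/
structure IsSpectralDensity (E : SpectralMeasure ℋ) (Ω : Set ℂ) (φ ψ : ℋ) (f : ℂ → ℂ) : Prop where
  analytic : AnalyticOnNhd ℂ f (withTrace Ω)
  integrableOn : IntegrableOn (fun ω : ℝ => f ω) (openTrace Ω)
  eq_integral : ∀ B : Set ℝ, MeasurableSet B → B ⊆ openTrace Ω →
    E.cmeas φ ψ B = ∫ ω in B, f ω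

open Classical in
/-- The number `E[φ, ψ](z)`, for `z ∈ Ω ∪ I`: the value at `z` of the holomorphic density of
`(E(·)φ, ψ)`, whose values on `Ω ∪ I` are unique. -/
def density (E : SpectralMeasure ℋ) (Ω : Set ℂ) (φ ψ : ℋ) (z : ℂ) : ℂ :=
  if h : ∃ f, IsSpectralDensity E Ω φ ψ f then h.choose z else 0

/-- `ν = A(λ)(i ψ)`, where `A(λ)` is the analytic continuation of `(λ - H)⁻¹` to
`Ω ∪ I ∪ {Im λ < 0}`: the functional `ν ∈ X'` is given by
`⟨ν | φ⟩ = ∫ (λ - ω)⁻¹ d(E(ω)ψ, φ) + 2πi E[ψ, φ](λ)` if `λ ∈ Ω`,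
`⟨ν | φ⟩ = lim_{y → -0} ∫ (x + iy - ω)⁻¹ d(E(ω)ψ, φ)` if `λ = x ∈ I`,
`⟨ν | φ⟩ = ∫ (λ - ω)⁻¹ d(E(ω)ψ, φ)` if `Im λ < 0`.
The three cases exclude each other (`Ω` lies in the upper half plane), and `ν` is determined by `ψ`. -/
def Rigging.IsContinuedResolvent (R : Rigging X ℋ) (E : SpectralMeasure ℋ) (Ω : Set ℂ) (z : ℂ)
    (ψ : X) (ν : X →L⋆[ℂ] ℂ) : Prop :=
  (z ∈ Ω ∧ ∀ φ : X, ν φ =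
      E.int (fun ω : ℝ => (z - ω)⁻¹) (R.incl ψ) (R.incl φ)
        + 2 * Real.pi * Complex.I * density E Ω (R.incl ψ) (R.incl φ) z) ∨
  (∃ x ∈ openTrace Ω, z = (x : ℂ) ∧ ∀ φ : X, Tendsto
      (fun y : ℝ =>
        E.int (fun ω : ℝ => ((x : ℂ) + Complex.I * y - ω)⁻¹) (R.incl ψ) (R.incl φ))
      (𝓝[<] (0 : ℝ)) (𝓝 (ν φ))) ∨
  (z.im < 0 ∧ ∀ φ : X, ν φ =
      E.int (fun ω : ℝ => (z - ω)⁻¹) (R.incl ψ) (R.incl φ))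

/-- The standing assumptions on `T = H + K`, the spectral measure `E` of the selfadjoint operator
`H`, the domain `Ω`, the rigged Hilbert space `X ⊆ ℋ ⊆ X'` and the subspace `Y ⊆ X`. That `X` is a
dense subspace of `ℋ` with a stronger topology is part of `Rigging`; that `X` is a quasi-complete
barrelled locally convex Hausdorff space is expressed by type classes. -/
structure StandingAssumptions (R : Rigging X ℋ) (H K : ℋ →ₗ.[ℂ] ℋ) (E : SpectralMeasure ℋ)
    (Ω : Set ℂ) (Y : Submodule ℂ X) : Prop where
  isSelfAdjoint : IsSelfAdjoint H
  isResolution : E.IsResolutionOf H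
  dense_domain : Dense (K.domain : Set ℋ)
  admissible : IsAdmissibleDomain Ω
  /-- the spectral measure `(E(·)φ, φ)` has on `I` a density with an analytic continuation to
  `Ω ∪ I` -/
  exists_density : ∀ φ : X, ∃ f, IsSpectralDensity E Ω (R.incl φ) (R.incl φ) f
  /-- `E[·, ·](z)` is separately continuous on `X × X` -/
  continuous_left : ∀ z ∈ withTrace Ω, ∀ φ : X,
    Continuous fun ψ : X => density E Ω (R.incl ψ) (R.incl φ) z
  continuous_right : ∀ z ∈ withTrace Ω, ∀ ψ : X,
    Continuous fun φ : X => density E Ω (R.incl ψ) (R.incl φ) z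
  dense_Y : Dense (Y : Set X)
  /-- `H Y ⊆ X` -/
  map_H : ∀ y ∈ Y, ∃ h : R.incl y ∈ H.domain, H ⟨R.incl y, h⟩ ∈ range R.incl
  relBounded : IsRelBounded K H
  /-- `K* Y ⊆ X` -/
  map_K : ∀ y ∈ Y, ∃ h : R.incl y ∈ K†.domain, K† ⟨R.incl y, h⟩ ∈ range R.incl
  /-- `K^× A(z) i X ⊆ i X` -/
  cross_resolvent : ∀ z ∈ extendedDomain Ω, ∀ (ψ : X) (ν : X →L⋆[ℂ] ℂ),
    R.IsContinuedResolvent E Ω z ψ ν →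
      ∃ h : ν ∈ (R.cross K Y).domain, R.cross K Y ⟨ν, h⟩ ∈ range R.toDual

/-- `μ` is a generalized eigenfunction of `T = H + K` associated with `z`: a nonzero element of the
range of `A(z)` with `(id - A(z) K^×) μ = 0`. Here `A(z)` is applied to `K^× μ = i ξ`. -/
def Rigging.IsGeneralizedEigenfunction (R : Rigging X ℋ) (K : ℋ →ₗ.[ℂ] ℋ)
    (E : SpectralMeasure ℋ) (Ω : Set ℂ) (Y : Submodule ℂ X) (z : ℂ) (μ : X →L⋆[ℂ] ℂ) : Prop :=
  z ∈ extendedDomain Ω ∧ μ ≠ 0 ∧ (∃ ψ : X, R.IsContinuedResolvent E Ω z ψ μ) ∧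
    ∃ (h : μ ∈ (R.cross K Y).domain) (ξ : X) (ν : X →L⋆[ℂ] ℂ),
      R.cross K Y ⟨μ, h⟩ = R.toDual ξ ∧ R.IsContinuedResolvent E Ω z ξ ν ∧ μ - ν = 0

/-- `z` is a generalized eigenvalue of `T = H + K`. -/
def Rigging.IsGeneralizedEigenvalue (R : Rigging X ℋ) (K : ℋ →ₗ.[ℂ] ℋ)
    (E : SpectralMeasure ℋ) (Ω : Set ℂ) (Y : Submodule ℂ X) (z : ℂ) : Prop :=
  ∃ μ : X →L⋆[ℂ] ℂ, R.IsGeneralizedEigenfunction K E Ω Y z μ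

end Rigged

end

end RiggedSpectral

namespace RiggedSpectral

open scoped ComplexConjugate

/-! The eigenvalue equation says `μ = A(z) iξ` with `iξ = K^× μ`. For `φ ∈ Y` both `Hφ` and `K* φ`
lie in `X`, and `T* φ = Hφ + K* φ` (`adjoint_add`). Hence `⟨μ | T* φ⟩ = ⟨A(z) iξ | Hφ⟩ + (ξ, φ)`,
and everything rests on the identity `⟨A(z) iψ | Hφ⟩ = z ⟨A(z) iψ | φ⟩ - (ψ, φ)` of
`continuedResolvent_map`: the two terms `(ξ, φ)` cancel and `z ⟨μ | φ⟩` remains. This is continuous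
in `φ`, so `μ` lies in the domain of `T^×`, and density of `Y` gives `T^× μ = z μ`.

For nonreal `w` the resolvent integral satisfies this identity because `ω / (w - ω) = w / (w - ω) -
1` and `d(Eψ, Hφ) = ω d(Eψ, φ)`. That settles the lower half plane, and points of `I` follow by a
limit from below. On `Ω` the extra term must satisfy `E[ψ, Hφ](z) = z E[ψ, φ](z)`. The relation
between the measures gives this near a point of `I`, and the identity theorem carries it to `Ω ∪ I`
(`IsSpectralDensity.eq_mul`). -/

instance isFiniteMeasure_variation {α : Type*} [MeasurableSpace α] (μ : ComplexMeasure α) :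
    IsFiniteMeasure μ.variation := by
  -- The variation is the least measure dominating `‖μ s‖`, and `|z| ≤ |Re z| + |Im z|` shows that
  -- the sum of the total variations of the real and imaginary parts is such a measure.
  refine isFiniteMeasure_of_le
    ((ComplexMeasure.re μ).totalVariation + (ComplexMeasure.im μ).totalVariation) ?_
  refine VectorMeasure.variation_le_of_forall_enorm_le fun s hs => ?_
  have h : ‖μ s‖ₑ ≤ ‖(μ s).re‖ₑ + ‖(μ s).im‖ₑ := by
    rw [← ofReal_norm, ← ofReal_norm, ← ofReal_norm,
      ← ENNReal.ofReal_add (norm_nonneg _) (norm_nonneg _)]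
    exact ENNReal.ofReal_le_ofReal (Complex.norm_le_abs_re_add_abs_im _)
  refine h.trans ?_
  rw [Measure.add_apply]
  gcongr
  · exact SignedMeasure.enorm_le_totalVariation (ComplexMeasure.re μ) s
  · exact SignedMeasure.enorm_le_totalVariation (ComplexMeasure.im μ) s

/-- Bounded measurable functions are generated by indicators, sums and bounded pointwise limits. -/
theorem bounded_measurable_induction {α : Type*} [MeasurableSpace α] {P : (α → ℂ) → Prop}
    (indicator : ∀ (c : ℂ) (s : Set α), MeasurableSet s → P (s.indicator fun _ => c))
    (add : ∀ (f g : α → ℂ) (C D : ℝ), Measurable f → Measurable g → (∀ x, ‖f x‖ ≤ C) →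
      (∀ x, ‖g x‖ ≤ D) → P f → P g → P (f + g))
    (lim : ∀ (F : ℕ → α → ℂ) (f : α → ℂ) (C : ℝ), (∀ n, Measurable (F n)) →
      (∀ n x, ‖F n x‖ ≤ C) → (∀ x, Tendsto (fun n => F n x) atTop (𝓝 (f x))) →
      (∀ n, P (F n)) → P f)
    {f : α → ℂ} {C : ℝ} (hf : Measurable f) (hC : ∀ x, ‖f x‖ ≤ C) : P f := by
  classical
  have simple (F : SimpleFunc α ℂ) : P F := by
    induction F using SimpleFunc.induction with
    | const c hs =>
      rw [SimpleFunc.coe_piecewise, SimpleFunc.coe_const, SimpleFunc.coe_const]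
      convert indicator c _ hs using 1
      exact Set.piecewise_eq_indicator
    | @add f g _ hf hg =>
      obtain ⟨C, hC⟩ := f.exists_forall_norm_le
      obtain ⟨D, hD⟩ := g.exists_forall_norm_le
      exact add f g C D f.measurable g.measurable hC hD hf hg
  -- A point of `α` is needed to know `0 ≤ C`; on an empty type every function is the zero simple
  -- function.
  rcases isEmpty_or_nonempty α with hα | ⟨⟨a⟩⟩
  · convert simple 0
  have hC0 : 0 ≤ C := (norm_nonneg _).trans (hC a)
  exact lim (fun n => hf.stronglyMeasurable.approxBounded C n) f C
    (fun n => SimpleFunc.measurable _)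
    (fun n x => hf.stronglyMeasurable.norm_approxBounded_le hC0 n x)
    (fun x => hf.stronglyMeasurable.tendsto_approxBounded_of_norm_le (hC x)) (fun n => simple _)

/-! ### Integration of bounded functions against complex measures -/

section ComplexMeasure

variable {α : Type*} [MeasurableSpace α]

local notation "cmul" => ContinuousLinearMap.mul ℝ ℂ

theorem integrable_of_bounded (μ : ComplexMeasure α) {g : α → ℂ} {C : ℝ} (hg : Measurable g)
    (hC : ∀ x, ‖g x‖ ≤ C) : μ.Integrable g :=
  Integrable.of_bound (μ := μ.variation) hg.aestronglyMeasurable C (Eventually.of_forall hC)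

/-- The constant can be absorbed into the bilinear pairing on either side, and the two resulting
pairings agree by associativity. -/
theorem integral_const_mul (μ : ComplexMeasure α) {g : α → ℂ} (hg : μ.Integrable g) (c : ℂ) :
    μ.integral (fun x => c * g x) cmul = c * μ.integral g cmul := by
  have h₁ := VectorMeasure.continuousLinearMap_apply_integral (B := cmul) (C := cmul c) hg
  have h₂ := VectorMeasure.integral_continuousLinearMap_comp (B := cmul) (C := cmul c) hg
  simp only [ContinuousLinearMap.mul_apply'] at h₁ h₂
  rw [h₁, h₂]
  congr 1
  ext
  simp [mul_assoc]

theorem tendsto_integral_mul (μ : ComplexMeasure α) {h : α → ℂ} (hh : μ.Integrable h)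
    {F : ℕ → α → ℂ} {f : α → ℂ} {C : ℝ} (hF : ∀ n, Measurable (F n))
    (hC : ∀ n x, ‖F n x‖ ≤ C) (hlim : ∀ x, Tendsto (fun n => F n x) atTop (𝓝 (f x))) :
    Tendsto (fun n => μ.integral (fun x => F n x * h x) cmul) atTop
      (𝓝 (μ.integral (fun x => f x * h x) cmul)) := by
  refine VectorMeasure.tendsto_integral_of_dominated_convergence (fun x => C * ‖h x‖)
    (fun n => (hF n).aestronglyMeasurable.mul hh.1) (hh.norm.const_mul C)
    (fun n => Eventually.of_forall fun x => ?_)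
    (Eventually.of_forall fun x => (hlim x).mul_const _)
  rw [norm_mul]
  exact mul_le_mul_of_nonneg_right (hC n x) (norm_nonneg _)

theorem tendsto_integral_bounded (μ : ComplexMeasure α)
    {F : ℕ → α → ℂ} {f : α → ℂ} {C : ℝ} (hF : ∀ n, Measurable (F n))
    (hC : ∀ n x, ‖F n x‖ ≤ C) (hlim : ∀ x, Tendsto (fun n => F n x) atTop (𝓝 (f x))) :
    Tendsto (fun n => μ.integral (F n) cmul) atTop (𝓝 (μ.integral f cmul)) :=
  VectorMeasure.tendsto_integral_filter_of_norm_le_const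
    (Eventually.of_forall fun n => (hF n).aestronglyMeasurable)
    ⟨C, Eventually.of_forall fun n => Eventually.of_forall (hC n)⟩ (Eventually.of_forall hlim)

theorem integrable_bounded_mul (μ : ComplexMeasure α) {g h : α → ℂ} {C : ℝ} (hh : μ.Integrable h)
    (hg : Measurable g) (hC : ∀ x, ‖g x‖ ≤ C) : μ.Integrable fun x => g x * h x :=
  MeasureTheory.Integrable.bdd_mul (μ := μ.variation) hh hg.aestronglyMeasurable
    (Eventually.of_forall hC)

/-- If `dν = h dμ` then `∫ g dν = ∫ g h dμ`. -/
theorem integral_eq_of_setIntegral (μ ν : ComplexMeasure α) {h : α → ℂ} (hh : μ.Integrable h)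
    (hν : ∀ s, MeasurableSet s → ν s = (μ.restrict s).integral h cmul)
    {g : α → ℂ} {C : ℝ} (hg : Measurable g) (hC : ∀ x, ‖g x‖ ≤ C) :
    ν.integral g cmul = μ.integral (fun x => g x * h x) cmul := by
  refine bounded_measurable_induction
    (P := fun g => ν.integral g cmul = μ.integral (fun x => g x * h x) cmul) ?_ ?_ ?_ hg hC
  · intro c s hs
    have : (fun x => s.indicator (fun _ => c) x * h x) = s.indicator fun x => c * h x := by
      ext x
      by_cases hx : x ∈ s <;> simp [hx]
    rw [VectorMeasure.integral_indicator_const c hs, this, VectorMeasure.integral_indicator hs,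
      integral_const_mul _ hh.restrict, hν s hs, ContinuousLinearMap.mul_apply']
  · intro f g C D hf hg hC hD hPf hPg
    simp only [Pi.add_apply, add_mul]
    rw [VectorMeasure.integral_fun_add (integrable_bounded_mul μ hh hf hC)
      (integrable_bounded_mul μ hh hg hD), ← hPf, ← hPg]
    exact VectorMeasure.integral_add (integrable_of_bounded ν hf hC) (integrable_of_bounded ν hg hD)
  · intro F f C hF hC hlim hP
    refine tendsto_nhds_unique (tendsto_integral_bounded ν hF hC hlim) ?_
    simp only [hP]
    exact tendsto_integral_mul μ hh hF hC hlim

theorem integral_conj_bounded (μ ν : ComplexMeasure α) (hν : ∀ s, ν s = conj (μ s))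
    {g : α → ℂ} {C : ℝ} (hg : Measurable g) (hC : ∀ x, ‖g x‖ ≤ C) :
    ν.integral (fun x => conj (g x)) cmul = conj (μ.integral g cmul) := by
  have hm {f : α → ℂ} (hf : Measurable f) : Measurable fun x => conj (f x) :=
    Complex.continuous_conj.measurable.comp hf
  refine bounded_measurable_induction
    (P := fun g => ν.integral (fun x => conj (g x)) cmul = conj (μ.integral g cmul))
    ?_ ?_ ?_ hg hC
  · intro c s hs
    have : (fun x => conj (s.indicator (fun _ => c) x)) = s.indicator fun _ => conj c := by
      ext x
      by_cases hx : x ∈ s <;> simp [hx]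
    rw [this, VectorMeasure.integral_indicator_const _ hs,
      VectorMeasure.integral_indicator_const c hs]
    simp [hν]
  · intro f g C D hf hg hC hD hPf hPg
    rw [VectorMeasure.integral_add (integrable_of_bounded μ hf hC) (integrable_of_bounded μ hg hD),
      map_add, ← hPf, ← hPg]
    simp only [Pi.add_apply, map_add]
    exact VectorMeasure.integral_fun_add
      (integrable_of_bounded ν (hm hf) (C := C) fun x => by simpa using hC x)
      (integrable_of_bounded ν (hm hg) (C := D) fun x => by simpa using hD x)
  · intro F f C hF hC hlim hP
    refine tendsto_nhds_unique (tendsto_integral_bounded ν (C := C) (fun n => hm (hF n))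
      (fun n x => by simpa using hC n x)
      fun x => (Complex.continuous_conj.tendsto _).comp (hlim x)) ?_
    simp only [hP]
    exact (Complex.continuous_conj.tendsto _).comp (tendsto_integral_bounded μ hF hC hlim)

/-- If `μ` has on `s` the density `f` with respect to `m`, then `∫_s g dμ = ∫_s g f dm`. -/
theorem setIntegral_eq_integral_mul_density (μ : ComplexMeasure α) (m : Measure α) {s : Set α}
    (hs : MeasurableSet s) {f : α → ℂ} (hf : IntegrableOn f s m)
    (hμ : ∀ t, MeasurableSet t → t ⊆ s → μ t = ∫ x in t, f x ∂m)
    {g : α → ℂ} {C : ℝ} (hg : Measurable g) (hC : ∀ x, ‖g x‖ ≤ C) :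
    (μ.restrict s).integral g cmul = ∫ x in s, g x * f x ∂m := by
  refine bounded_measurable_induction
    (P := fun g => (μ.restrict s).integral g cmul = ∫ x in s, g x * f x ∂m) ?_ ?_ ?_ hg hC
  · intro c t ht
    have : (fun x => t.indicator (fun _ => c) x * f x) = t.indicator fun x => c * f x := by
      ext x
      by_cases hx : x ∈ t <;> simp [hx]
    rw [VectorMeasure.integral_indicator_const c ht, this, MeasureTheory.integral_indicator ht,
      Measure.restrict_restrict ht, MeasureTheory.integral_const_mul,
      VectorMeasure.restrict_apply _ hs ht, hμ _ (ht.inter hs) inter_subset_right,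
      ContinuousLinearMap.mul_apply']
  · intro g k C D hg hk hC hD hPg hPk
    simp only [Pi.add_apply, add_mul]
    rw [MeasureTheory.integral_add
      (hf.bdd_mul hg.aestronglyMeasurable (Eventually.of_forall hC))
      (hf.bdd_mul hk.aestronglyMeasurable (Eventually.of_forall hD)), ← hPg, ← hPk]
    exact VectorMeasure.integral_add (integrable_of_bounded _ hg hC) (integrable_of_bounded _ hk hD)
  · intro F g C hF hC hlim hP
    refine tendsto_nhds_unique (tendsto_integral_bounded _ hF hC hlim) ?_
    simp only [hP]
    refine tendsto_integral_of_dominated_convergence (fun x => C * ‖f x‖)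
      (fun n => (hF n).aestronglyMeasurable.mul hf.1) (hf.norm.const_mul C)
      (fun n => Eventually.of_forall fun x => ?_)
      (Eventually.of_forall fun x => (hlim x).mul_const _)
    rw [norm_mul]
    exact mul_le_mul_of_nonneg_right (hC n x) (norm_nonneg _)

end ComplexMeasure

/-! ### Resolvent integrals of a spectral measure -/

section SpectralMeasure

variable {ℋ : Type*} [NormedAddCommGroup ℋ] [InnerProductSpace ℂ ℋ] [CompleteSpace ℋ]

theorem SpectralMeasure.cmeas_apply (E : SpectralMeasure ℋ) (φ ψ : ℋ) {B : Set ℝ}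
    (hB : MeasurableSet B) : E.cmeas φ ψ B = inner ℂ ψ (E.proj B φ) :=
  if_pos hB

theorem SpectralMeasure.inner_proj_left (E : SpectralMeasure ℋ) {B : Set ℝ} (hB : MeasurableSet B)
    (φ ψ : ℋ) : inner ℂ (E.proj B φ) ψ = inner ℂ φ (E.proj B ψ) := by
  have h := (E.isStarProjection B hB).isSelfAdjoint.adjoint_eq
  conv_lhs => rw [← h]
  exact ContinuousLinearMap.adjoint_inner_left _ _ _

theorem SpectralMeasure.cmeas_swap (E : SpectralMeasure ℋ) (φ ψ : ℋ) (B : Set ℝ) :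
    E.cmeas φ ψ B = conj (E.cmeas ψ φ B) := by
  by_cases hB : MeasurableSet B
  · rw [E.cmeas_apply _ _ hB, E.cmeas_apply _ _ hB, inner_conj_symm, E.inner_proj_left hB]
  · rw [VectorMeasure.not_measurable _ hB, VectorMeasure.not_measurable _ hB, map_zero]

/-- Since `E(B)` is selfadjoint and `E(B) E(C) = E(B ∩ C)`, projecting a vector localizes the
measure. This turns the formula for `(Hx, y)` into one for the measure `(E(·)Hx, y)`. -/
theorem SpectralMeasure.cmeas_proj_right (E : SpectralMeasure ℋ) (φ ψ : ℋ) {B : Set ℝ}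
    (hB : MeasurableSet B) : E.cmeas φ (E.proj B ψ) = (E.cmeas φ ψ).restrict B := by
  ext C hC
  rw [VectorMeasure.restrict_apply _ hB hC, E.cmeas_apply _ _ hC, E.cmeas_apply _ _ (hC.inter hB),
    E.inner_proj_left hB, inter_comm, E.proj_inter B C hB hC, mul_apply_eq_comp]

theorem SpectralMeasure.int_swap (E : SpectralMeasure ℋ) (φ ψ : ℋ) {g : ℝ → ℂ} {C : ℝ}
    (hg : Measurable g) (hC : ∀ x, ‖g x‖ ≤ C) :
    E.int (fun ω => conj (g ω)) φ ψ = conj (E.int g ψ φ) :=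
  integral_conj_bounded _ _ (E.cmeas_swap φ ψ) hg hC

variable {E : SpectralMeasure ℋ} {H : ℋ →ₗ.[ℂ] ℋ}

/-- `d(E Hx, ψ) = ω d(E x, ψ)`. -/
theorem SpectralMeasure.IsResolutionOf.cmeas_map (hE : E.IsResolutionOf H) (x : H.domain) (ψ : ℋ)
    {B : Set ℝ} (hB : MeasurableSet B) :
    E.cmeas (H x) ψ B = ((E.cmeas x ψ).restrict B).integral (fun ω : ℝ => (ω : ℂ))
      (ContinuousLinearMap.mul ℝ ℂ) := by
  rw [E.cmeas_apply _ _ hB, ← E.inner_proj_left hB, hE.inner_apply, SpectralMeasure.int,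
    E.cmeas_proj_right _ _ hB]

theorem SpectralMeasure.IsResolutionOf.int_map (hE : E.IsResolutionOf H) (x : H.domain) (ψ : ℋ)
    {g : ℝ → ℂ} {C : ℝ} (hg : Measurable g) (hC : ∀ ω, ‖g ω‖ ≤ C) :
    E.int g (H x) ψ = E.int (fun ω => g ω * ω) x ψ :=
  integral_eq_of_setIntegral _ _ (hE.integrable x ψ) (fun _ hs => hE.cmeas_map x ψ hs) hg hC

theorem measurable_resolvent (w : ℂ) : Measurable fun ω : ℝ => (w - ω)⁻¹ := by fun_prop

theorem norm_resolvent_le {w : ℂ} (hw : w.im ≠ 0) (ω : ℝ) : ‖(w - ω)⁻¹‖ ≤ |w.im|⁻¹ := by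
  rw [norm_inv]
  refine inv_anti₀ (abs_pos.2 hw) ?_
  simpa using Complex.abs_im_le_norm (w - ω)

/-- Integrate `ω / (w - ω) = w / (w - ω) - 1`; the constant contributes the inner product because
`E(ℝ) = 1`. -/
theorem SpectralMeasure.IsResolutionOf.int_resolvent_map_left (hE : E.IsResolutionOf H)
    (x : H.domain) (ψ : ℋ) {w : ℂ} (hw : w.im ≠ 0) :
    E.int (fun ω : ℝ => (w - ω)⁻¹) (H x) ψ =
      w * E.int (fun ω : ℝ => (w - ω)⁻¹) x ψ - inner ℂ ψ (x : ℋ) := by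
  have hi : (E.cmeas x ψ).Integrable fun ω : ℝ => (w - ω)⁻¹ :=
    integrable_of_bounded _ (measurable_resolvent w) (norm_resolvent_le hw)
  have h (ω : ℝ) : (w - ω)⁻¹ * ω = w * (w - ω)⁻¹ - 1 := by
    have : w - ω ≠ 0 := fun h => hw (by simpa using congrArg Complex.im h)
    field_simp
    ring
  rw [hE.int_map x ψ (measurable_resolvent w) (norm_resolvent_le hw)]
  simp only [h, SpectralMeasure.int]
  rw [VectorMeasure.integral_fun_sub (MeasureTheory.Integrable.const_mul hi w)
    (MeasureTheory.integrable_const _), integral_const_mul _ hi, VectorMeasure.integral_const,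
    E.cmeas_apply _ _ MeasurableSet.univ, E.proj_univ]
  simp

/-- `((w - H)⁻¹ ψ, H x) = w ((w - H)⁻¹ ψ, x) - (ψ, x)`. -/
theorem SpectralMeasure.IsResolutionOf.int_resolvent_map_right (hE : E.IsResolutionOf H)
    (x : H.domain) (ψ : ℋ) {w : ℂ} (hw : w.im ≠ 0) :
    E.int (fun ω : ℝ => (w - ω)⁻¹) ψ (H x) =
      w * E.int (fun ω : ℝ => (w - ω)⁻¹) ψ x - inner ℂ (x : ℋ) ψ := by
  have hw' : (conj w).im ≠ 0 := by simpa using hw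
  -- Exchanging the two vectors conjugates the measure, so the claim is the conjugate of the left
  -- version at `conj w`.
  have h (y : ℋ) : E.int (fun ω : ℝ => (w - ω)⁻¹) ψ y =
      conj (E.int (fun ω : ℝ => (conj w - ω)⁻¹) y ψ) := by
    rw [← E.int_swap ψ y (measurable_resolvent (conj w)) (norm_resolvent_le hw')]
    simp
  rw [h, h, hE.int_resolvent_map_left x ψ hw']
  simp

end SpectralMeasure

/-! ### Holomorphic spectral densities -/

section Density

variable {ℋ : Type*} [NormedAddCommGroup ℋ] [InnerProductSpace ℂ ℋ] [CompleteSpace ℋ]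
variable {E : SpectralMeasure ℋ} {H : ℋ →ₗ.[ℂ] ℋ} {Ω : Set ℂ}

theorem ofReal_mem_withTrace {x : ℝ} (hx : x ∈ openTrace Ω) : (x : ℂ) ∈ withTrace Ω :=
  Or.inr ⟨x, hx, rfl⟩

/-- `Ω ∪ I` lies between the connected set `Ω` and its closure. Connectedness is what the identity
theorem needs. -/
theorem IsAdmissibleDomain.isPreconnected_withTrace (hΩ : IsAdmissibleDomain Ω) :
    IsPreconnected (withTrace Ω) := by
  refine hΩ.simplyConnected.isPathConnected.isConnected.isPreconnected.subset_closure
    subset_union_left (union_subset subset_closure ?_)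
  rintro _ ⟨x, hx, rfl⟩
  exact interior_subset (s := realTrace Ω) hx

theorem isSpectralDensity_density {φ ψ : ℋ} (h : ∃ f, IsSpectralDensity E Ω φ ψ f) :
    IsSpectralDensity E Ω φ ψ (density E Ω φ ψ) := by
  have : density E Ω φ ψ = h.choose := by
    ext z
    simp [density, h]
  rw [this]
  exact h.choose_spec

/-- Densities of `(E(·)φ, ψ)` exist by polarization. -/
theorem IsSpectralDensity.exists_of_polarization {φ ψ : ℋ}
    (h₁ : ∃ f, IsSpectralDensity E Ω (φ + ψ) (φ + ψ) f)
    (h₂ : ∃ f, IsSpectralDensity E Ω (φ - ψ) (φ - ψ) f)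
    (h₃ : ∃ f, IsSpectralDensity E Ω (φ + Complex.I • ψ) (φ + Complex.I • ψ) f)
    (h₄ : ∃ f, IsSpectralDensity E Ω (φ - Complex.I • ψ) (φ - Complex.I • ψ) f) :
    ∃ f, IsSpectralDensity E Ω φ ψ f := by
  obtain ⟨f₁, h₁⟩ := h₁
  obtain ⟨f₂, h₂⟩ := h₂
  obtain ⟨f₃, h₃⟩ := h₃
  obtain ⟨f₄, h₄⟩ := h₄
  -- The signs are those of the polarization identity for `(E(B)ψ, φ)` in Mathlib's convention,
  -- which is conjugate linear in the first slot.
  refine ⟨fun z => 1 / 4 * (f₁ z - f₂ z + Complex.I * f₃ z - Complex.I * f₄ z), ?_, ?_, ?_⟩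
  · exact analyticOnNhd_const.mul (((h₁.analytic.sub h₂.analytic).add
      (analyticOnNhd_const.mul h₃.analytic)).sub (analyticOnNhd_const.mul h₄.analytic))
  · exact (((h₁.integrableOn.sub h₂.integrableOn).add
      (h₃.integrableOn.const_mul _)).sub (h₄.integrableOn.const_mul _)).const_mul _
  · intro B hB hBI
    have i₁ := h₁.integrableOn.mono_set hBI
    have i₂ := h₂.integrableOn.mono_set hBI
    have i₃ := (h₃.integrableOn.mono_set hBI).const_mul Complex.I
    have i₄ := (h₄.integrableOn.mono_set hBI).const_mul Complex.I
    have i₁₂ : IntegrableOn (fun ω : ℝ => f₁ ω - f₂ ω) B := i₁.sub i₂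
    have i₁₂₃ : IntegrableOn (fun ω : ℝ => f₁ ω - f₂ ω + Complex.I * f₃ ω) B := i₁₂.add i₃
    rw [MeasureTheory.integral_const_mul, integral_sub i₁₂₃ i₄,
      integral_add i₁₂ i₃, integral_sub i₁ i₂, MeasureTheory.integral_const_mul,
      MeasureTheory.integral_const_mul,
      ← h₁.eq_integral B hB hBI, ← h₂.eq_integral B hB hBI, ← h₃.eq_integral B hB hBI,
      ← h₄.eq_integral B hB hBI]
    simp only [E.cmeas_apply _ _ hB, ← E.inner_proj_left hB]
    have := inner_map_polarization (E.proj B).toLinearMap φ ψ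
    simp only [ContinuousLinearMap.coe_coe] at this
    rw [this]
    ring

/-- `d(Eφ, Hx) = ω d(Eφ, x)` for densities, on bounded subsets of `I`. -/
theorem IsSpectralDensity.cmeas_map (hE : E.IsResolutionOf H) (x : H.domain) {φ : ℋ}
    {f : ℂ → ℂ} (hf : IsSpectralDensity E Ω φ x f) {B : Set ℝ} (hB : MeasurableSet B)
    (hBI : B ⊆ openTrace Ω) {C : ℝ} (hC : ∀ ω ∈ B, |ω| ≤ C) :
    E.cmeas φ (H x) B = ∫ ω in B, (ω : ℂ) * f ω := by
  -- Truncating `ω` to the bounded set `B` makes it a bounded integrand. The bound is `|C|` since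
  -- `C` may be negative when `B` is empty.
  have hm : Measurable (B.indicator fun ω : ℝ => (ω : ℂ)) :=
    Complex.measurable_ofReal.indicator hB
  have hb (ω : ℝ) : ‖B.indicator (fun ω : ℝ => (ω : ℂ)) ω‖ ≤ |C| := by
    by_cases h : ω ∈ B
    · simpa [h] using (hC ω h).trans (le_abs_self C)
    · simp [h]
  -- After the vectors are exchanged the density on `B` is `conj f`. Conjugating back leaves the
  -- real factor `ω` unchanged.
  have hint : IntegrableOn (fun ω : ℝ => conj (f ω)) B :=
    (Complex.conjLIE.toContinuousLinearEquiv.toContinuousLinearMap.integrable_comp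
      (hf.integrableOn.mono_set hBI))
  rw [E.cmeas_swap, hE.cmeas_map x φ hB,
    VectorMeasure.setIntegral_congr_fun (g := B.indicator fun ω : ℝ => (ω : ℂ))
      (fun ω hω => by simp [hω]),
    setIntegral_eq_integral_mul_density (E.cmeas x φ) volume hB hint ?_ hm hb, ← integral_conj]
  · refine setIntegral_congr_fun hB fun ω hω => ?_
    simp [hω]
  · intro t ht htB
    rw [E.cmeas_swap, hf.eq_integral t ht (htB.trans hBI), ← integral_conj]

/-- The measures `d(Eφ, Hx)` and `ω d(Eφ, x)` agree on bounded pieces of `I`, so the densities agree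
almost everywhere there, by continuity everywhere there, and by the identity theorem on all of `Ω ∪
I`. -/
theorem IsSpectralDensity.eq_mul (hΩ : IsAdmissibleDomain Ω) (hE : E.IsResolutionOf H)
    (x : H.domain) {φ : ℋ} {f g : ℂ → ℂ} (hf : IsSpectralDensity E Ω φ x f)
    (hg : IsSpectralDensity E Ω φ (H x) g) {z : ℂ} (hz : z ∈ withTrace Ω) : g z = z * f z := by
  obtain ⟨a, ha⟩ := hΩ.nonempty_openTrace
  -- `I` may be unbounded, so a bounded neighbourhood of `a` is used to keep `ω * f ω` integrable;
  -- the identity theorem needs no more.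
  let J := openTrace Ω ∩ Metric.ball a 1
  have hJo : IsOpen J := isOpen_interior.inter Metric.isOpen_ball
  have haJ : a ∈ J := ⟨ha, Metric.mem_ball_self one_pos⟩
  have hJb (ω : ℝ) (hω : ω ∈ J) : |ω| ≤ |a| + 1 := by
    have h₁ : |ω - a| < 1 := hω.2
    have h₂ := abs_add_le (ω - a) a
    rw [sub_add_cancel] at h₂
    linarith
  have hJI : J ⊆ openTrace Ω := inter_subset_left
  have hcont {k : ℂ → ℂ} (hk : AnalyticOnNhd ℂ k (withTrace Ω)) :
      ContinuousOn (fun ω : ℝ => k ω) J :=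
    hk.continuousOn.comp Complex.continuous_ofReal.continuousOn
      fun ω hω => ofReal_mem_withTrace (hJI hω)
  have hmul : AnalyticOnNhd ℂ (fun z => z * f z) (withTrace Ω) := analyticOnNhd_id.mul hf.analytic
  have hgi : IntegrableOn (fun ω : ℝ => g ω) J := hg.integrableOn.mono_set hJI
  have hfi : IntegrableOn (fun ω : ℝ => (ω : ℂ) * f ω) J := by
    refine (hf.integrableOn.mono_set hJI).bdd_mul (c := |a| + 1)
      Complex.measurable_ofReal.aestronglyMeasurable ?_
    filter_upwards [ae_restrict_mem hJo.measurableSet] with ω hω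
    simpa using hJb ω hω
  have hae : (fun ω : ℝ => g ω) =ᵐ[volume.restrict J] fun ω : ℝ => (ω : ℂ) * f ω := by
    refine hgi.ae_eq_of_forall_setIntegral_eq _ _ hfi fun s hs _ => ?_
    rw [Measure.restrict_restrict hs,
      ← hg.eq_integral _ (hs.inter hJo.measurableSet) (inter_subset_right.trans hJI),
      ← hf.cmeas_map hE x (hs.inter hJo.measurableSet) (inter_subset_right.trans hJI)
        fun ω hω => hJb ω hω.2]
  have heq : EqOn (fun ω : ℝ => g ω) (fun ω : ℝ => (ω : ℂ) * f ω) J :=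
    Measure.eqOn_open_of_ae_eq hae hJo (hcont hg.analytic) (hcont hmul)
  refine hg.analytic.eqOn_of_preconnected_of_frequently_eq hmul hΩ.isPreconnected_withTrace
    (ofReal_mem_withTrace ha) ?_ hz
  have ht : Tendsto (fun ω : ℝ => (ω : ℂ)) (𝓝[≠] a) (𝓝[≠] (a : ℂ)) :=
    Complex.continuous_ofReal.continuousAt.continuousWithinAt.tendsto_nhdsWithin
      fun ω hω => by simpa using hω
  refine ht.frequently (Eventually.frequently ?_)
  filter_upwards [nhdsWithin_le_nhds (hJo.mem_nhds haJ)] with ω hω using heq hω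

end Density

/-! ### The continued resolvent and the dual operator -/

section Rigged

variable {X : Type*} [AddCommGroup X] [Module ℂ X] [UniformSpace X] [IsUniformAddGroup X]
  [ContinuousSMul ℂ X]
variable {ℋ : Type*} [NormedAddCommGroup ℋ] [InnerProductSpace ℂ ℋ] [CompleteSpace ℋ]
variable {R : Rigging X ℋ} {H K : ℋ →ₗ.[ℂ] ℋ} {E : SpectralMeasure ℋ} {Ω : Set ℂ}
  {Y : Submodule ℂ X}

theorem StandingAssumptions.exists_density_pair (hyp : StandingAssumptions R H K E Ω Y)
    (φ ψ : X) : ∃ f, IsSpectralDensity E Ω (R.incl φ) (R.incl ψ) f := by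
  apply IsSpectralDensity.exists_of_polarization
  · simpa using hyp.exists_density (φ + ψ)
  · simpa using hyp.exists_density (φ - ψ)
  · simpa using hyp.exists_density (φ + Complex.I • ψ)
  · simpa using hyp.exists_density (φ - Complex.I • ψ)

/-- `⟨A(z) iψ | Hφ⟩ = z ⟨A(z) iψ | φ⟩ - (ψ, φ)`, where `η ∈ X` is the element `Hφ`. -/
theorem StandingAssumptions.continuedResolvent_map (hyp : StandingAssumptions R H K E Ω Y)
    {z : ℂ} {ψ : X} {ν : X →L⋆[ℂ] ℂ} (hν : R.IsContinuedResolvent E Ω z ψ ν) {φ η : X}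
    (hφ : R.incl φ ∈ H.domain) (hη : R.incl η = H ⟨R.incl φ, hφ⟩) :
    ν η = z * ν φ - R.toDual ψ φ := by
  have key {w : ℂ} (hw : w.im ≠ 0) :=
    hyp.isResolution.int_resolvent_map_right ⟨R.incl φ, hφ⟩ (R.incl ψ) hw
  change ν η = z * ν φ - inner ℂ (R.incl φ) (R.incl ψ)
  rw [← hη] at key
  rcases hν with ⟨hz, h⟩ | ⟨x, hx, rfl, h⟩ | ⟨hz, h⟩
  -- On `Ω` the integral alone already produces `-(ψ, φ)`; the density term is just multiplied by
  -- `z`.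
  · have hd := IsSpectralDensity.eq_mul hyp.admissible hyp.isResolution ⟨R.incl φ, hφ⟩
      (isSpectralDensity_density (hyp.exists_density_pair ψ φ))
      (hη ▸ isSpectralDensity_density (hyp.exists_density_pair ψ η)) (Or.inl hz)
    rw [← hη] at hd
    rw [h, h, key (hyp.admissible.im_pos z hz).ne', hd]
    ring
  · have hw : Tendsto (fun y : ℝ => (x : ℂ) + Complex.I * y) (𝓝[<] 0) (𝓝 (x : ℂ)) := by
      have : Continuous fun y : ℝ => (x : ℂ) + Complex.I * y := by fun_prop
      simpa using (this.tendsto 0).mono_left nhdsWithin_le_nhds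
    -- The identity holds at `x + iy` for every `y < 0`, and both sides converge as `y → -0`.
    refine tendsto_nhds_unique ((h η).congr' ?_) ((hw.mul (h φ)).sub_const _)
    filter_upwards [self_mem_nhdsWithin] with y hy
    exact key (by simpa using (show y < 0 from hy).ne)
  · rw [h, h, key hz.ne]

/-- `T† = H + K†` on `Y`, for `T = H + K`. -/
theorem StandingAssumptions.adjoint_add (hyp : StandingAssumptions R H K E Ω Y) {v : ℋ}
    (hH : v ∈ H.domain) (hK : v ∈ K†.domain) :
    ∃ h : v ∈ (H + K)†.domain, (H + K)† ⟨v, h⟩ = H ⟨v, hH⟩ + K† ⟨v, hK⟩ := by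
  have hdense := hyp.isSelfAdjoint.dense_domain
  obtain ⟨hdom, -⟩ := hyp.relBounded
  -- Relative boundedness includes `D(H) ⊆ D(K)`, so `T` has the dense domain of `H` and its adjoint
  -- is determined by the pairing.
  have hdom' : (H + K).domain = H.domain := inf_eq_left.2 hdom
  have hformal : H.IsFormalAdjoint H := by
    have h := LinearPMap.adjoint_isFormalAdjoint hdense
    rwa [LinearPMap.isSelfAdjoint_def.1 hyp.isSelfAdjoint] at h
  have h (x : (H + K).domain) :
      inner ℂ (H ⟨v, hH⟩ + K† ⟨v, hK⟩) (x : ℋ) = inner ℂ v ((H + K) x) := by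
    rw [LinearPMap.add_apply, inner_add_left, inner_add_right]
    congr 1
    · exact hformal ⟨v, hH⟩ ⟨x, x.2.1⟩
    · exact LinearPMap.adjoint_isFormalAdjoint hyp.dense_domain ⟨v, hK⟩ ⟨x, x.2.2⟩
  exact ⟨LinearPMap.mem_adjoint_domain_of_exists _ ⟨_, h⟩,
    LinearPMap.adjoint_apply_eq (by rwa [hdom']) _ h⟩

theorem Rigging.incl_restrictTo (R : Rigging X ℋ) (S : ℋ →ₗ.[ℂ] ℋ) (Y : Submodule ℂ X)
    (y : (R.restrictTo S Y).domain) : R.incl (R.restrictTo S Y y) = S ⟨R.incl y, y.2.2.1⟩ :=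
  R.incl_restrictFun S Y y

theorem StandingAssumptions.restrictTo_adjoint_domain (hyp : StandingAssumptions R H K E Ω Y) :
    (R.restrictTo K† Y).domain = Y :=
  le_antisymm (fun _ hy => hy.1) fun y hy => ⟨hy, hyp.map_K y hy⟩

/-- `T* y = Hy + K* y` is a sum of two elements of `X`, so no vector of `Y` is lost and the dual is
taken on a dense domain. -/
theorem StandingAssumptions.restrictTo_adjoint_add_domain
    (hyp : StandingAssumptions R H K E Ω Y) : (R.restrictTo (H + K)† Y).domain = Y := by
  refine le_antisymm (fun _ hy => hy.1) fun y hy => ?_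
  obtain ⟨hH, a, ha⟩ := hyp.map_H y hy
  obtain ⟨hK, b, hb⟩ := hyp.map_K y hy
  obtain ⟨hT, h⟩ := hyp.adjoint_add hH hK
  exact ⟨hy, hT, a + b, by rw [map_add, ha, hb, h]⟩

/-- A generalized eigenfunction of `T` is an eigenvector of the dual operator `T^×`. -/
theorem StandingAssumptions.cross_eq_smul (hyp : StandingAssumptions R H K E Ω Y) {z : ℂ}
    {μ : X →L⋆[ℂ] ℂ} (hμ : R.IsGeneralizedEigenfunction K E Ω Y z μ) :
    ∃ h : μ ∈ (R.cross (H + K) Y).domain, R.cross (H + K) Y ⟨μ, h⟩ = z • μ := by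
  obtain ⟨-, -, -, hd, ξ, ν, hξ, hν, hμν⟩ := hμ
  -- From here on `μ` itself is `A(z) iξ`, with `iξ = K^× μ`.
  obtain rfl := sub_eq_zero.1 hμν
  have hKd : Dense ((R.restrictTo K† Y).domain : Set X) := by
    rw [hyp.restrictTo_adjoint_domain]
    exact hyp.dense_Y
  have hTd : Dense ((R.restrictTo (H + K)† Y).domain : Set X) := by
    rw [hyp.restrictTo_adjoint_add_domain]
    exact hyp.dense_Y
  have key (φ : (R.restrictTo (H + K)† Y).domain) :
      μ (R.restrictTo (H + K)† Y φ) = (z • μ) φ := by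
    obtain ⟨hH, a, ha⟩ := hyp.map_H φ φ.2.1
    have hφK : (φ : X) ∈ (R.restrictTo K† Y).domain := by
      rw [hyp.restrictTo_adjoint_domain]
      exact φ.2.1
    have hT : R.restrictTo (H + K)† Y φ = a + R.restrictTo K† Y ⟨φ, hφK⟩ := by
      apply R.injective
      obtain ⟨_, h⟩ := hyp.adjoint_add hH hφK.2.1
      rw [map_add, R.incl_restrictTo, R.incl_restrictTo, ha, h]
    have hK : μ (R.restrictTo K† Y ⟨φ, hφK⟩) = R.toDual ξ φ := by
      rw [← hξ]
      exact (dualOp_apply hKd ⟨μ, hd⟩ ⟨φ, hφK⟩).symm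
    rw [hT, map_add, hK, hyp.continuedResolvent_map hν hH ha, sub_add_cancel]
    rfl
  -- By `key`, `φ ↦ ⟨μ | T* φ⟩` is the restriction of the continuous functional `z • μ`.
  have hmem : μ ∈ (R.cross (H + K) Y).domain := by
    change Continuous fun φ => μ (R.restrictTo (H + K)† Y φ)
    simp only [key]
    fun_prop
  refine ⟨hmem, antidual_eq_of_dense hTd fun φ => ?_⟩
  rw [← key]
  exact dualOp_apply hTd ⟨μ, hmem⟩ φ

end Rigged

end RiggedSpectral

theorem theorem3p5
    {X : Type*} [AddCommGroup X] [Module ℂ X] [UniformSpace X] [IsUniformAddGroup X]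
    [ContinuousSMul ℂ X] [LocallyConvexSpace ℝ X] [T2Space X]
    [QuasiCompleteSpace ℂ X] [BarrelledSpace ℂ X]
    {ℋ : Type*} [NormedAddCommGroup ℋ] [InnerProductSpace ℂ ℋ] [CompleteSpace ℋ]
    (R : RiggedSpectral.Rigging X ℋ) (H K : ℋ →ₗ.[ℂ] ℋ) (E : RiggedSpectral.SpectralMeasure ℋ)
    (Ω : Set ℂ) (Y : Submodule ℂ X)
    (hyp : RiggedSpectral.StandingAssumptions R H K E Ω Y) :
    (∀ (z : ℂ) (μ : X →L⋆[ℂ] ℂ), R.IsGeneralizedEigenfunction K E Ω Y z μ →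
      ∃ h : μ ∈ (R.cross (H + K) Y).domain, R.cross (H + K) Y ⟨μ, h⟩ = z • μ) ∧
    (∀ z : ℂ, R.IsGeneralizedEigenvalue K E Ω Y z →
      ∃ (μ : X →L⋆[ℂ] ℂ) (h : μ ∈ (R.cross (H + K) Y).domain),
        μ ≠ 0 ∧ R.cross (H + K) Y ⟨μ, h⟩ = z • μ) :=
  ⟨fun _ _ hμ => hyp.cross_eq_smul hμ, fun _ ⟨μ, hμ⟩ =>
    have ⟨h, hz⟩ := hyp.cross_eq_smul hμ
    ⟨μ, h, hμ.2.1, hz⟩⟩
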